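/- Let $[m]=\{1,\dots,m\}$. For a positive integer $k$, a family $\mathcal F$ of subsets of $[m]$ is \emph{$k$-union-free} if $\bigcup_{A\in\mathcal A}A\neq\bigcup_{B\in\mathcal B}B$ for any two distinct subfamilies $\mathcal A,\mathcal B\subseteq\mathcal F$ with $1\le|\mathcal A|,|\mathcal B|\le k$. Let $f(k,r,m)$ be the maximum cardinality of a $k$-union-free family of $r$-element subsets of $[m]$. For $k\ge 2$, a real number $C$ and $m_0\in\mathbb N$, call $(C,m_0)$ \emph{admissible for $k$} if $$f(k,r,m)\le C\,m^{\lceil r/(k-1)\rceil}\qquad\text{for all } m\ge m_0 \text{ and all } r\in[m].$$ Let $P$ be a system of $m$ paths over $n$ nodes, given as a Boolean $m\times n$ matrix whose entry $(p,u)$ is $1$ iff node $u$ lies on path $p$. For $U\subseteq[n]$ let $P(U)\subseteq[m]$ be the set of paths containing at least one node of $U$. $P$ is \emph{$k$-identifiable} if $P(U)\ne P(W)$ for all distinct $U,W\subseteq[n]$ with $|U|,|W|\le k$, and $\mu(P)$ is the largest $k\le n$ such that $P$ is $k$-identifiable. \textbf{Theorem.} (i) There are constants $C>0$ and $m_0$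 such that $(C,m_0)$ is admissible for every $k\ge2$. (ii) Let $k\ge 2$, let $(C,m_0)$ be any pair admissible for $k$, let $m\ge m_0$, and let $P$ be a system of $m$ paths over $n$ nodes. If $$n>\sum_{r\in[m]}C\,m^{\lceil r/(k-1)\rceil},$$ then $P$ is not $k$-identifiable, and $\mu(P)<k$. -/

import Mathlib

namespace Tomography

/-- A system of `m` paths over `n` nodes, as a Boolean `m × n` matrix: `P p u = true` iff the node
`u` lies on the path `p`. -/
abbrev PathSystem (m n : ℕ) : Type := Matrix (Fin m) (Fin n) Bool

/-- The set of paths that touch at least one node of `U`. -/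
def PathSystem.touching {m n : ℕ} (P : PathSystem m n) (U : Finset (Fin n)) : Finset (Fin m) :=
  U.biUnion fun u => Finset.univ.filter fun p => P p u = true

/-- `P` is `k`-identifiable: distinct node sets of size at most `k` touch distinct sets of paths. -/
def PathSystem.IsIdentifiable {m n : ℕ} (P : PathSystem m n) (k : ℕ) : Prop :=
  ∀ U W : Finset (Fin n), U.card ≤ k → W.card ≤ k → U ≠ W → P.touching U ≠ P.touching W

open Classical in
/-- The maximal `k ≤ n` such that `P` is `k`-identifiable (every `P` is `0`-identifiable). -/
noncomputable def PathSystem.maxIdentifiability {m n : ℕ} (P : PathSystem m n) : ℕ :=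
  Nat.findGreatest P.IsIdentifiable n

/-- The hypergraph `F` is `k`-union-free: two distinct sets of edges of `F`, both with at least one
and at most `k` edges, have distinct unions. -/
def IsUnionFree {m : ℕ} (k : ℕ) (F : Finset (Finset (Fin m))) : Prop :=
  ∀ A B : Finset (Finset (Fin m)), A ⊆ F → B ⊆ F →
    1 ≤ A.card → A.card ≤ k → 1 ≤ B.card → B.card ≤ k → A ≠ B → A.biUnion id ≠ B.biUnion id

/-- All edges of the hypergraph `F` have size `r`. -/
def IsRegular {m : ℕ} (r : ℕ) (F : Finset (Finset (Fin m))) : Prop :=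
  ∀ A ∈ F, A.card = r

open Classical in
/-- `f(k, r, m)`: the maximum cardinality of a `k`-union-free `r`-regular hypergraph on a vertex set
of size `m`. -/
noncomputable def maxUnionFree (k r m : ℕ) : ℕ :=
  (Finset.univ.filter fun F : Finset (Finset (Fin m)) => IsUnionFree k F ∧ IsRegular r F).sup
    Finset.card

/-- `C` and `m₀` are constants in the bound `f(k, r, m) ≤ C m ^ ⌈r / (k - 1)⌉`, valid for all
`m ≥ m₀` and uniformly in `r ∈ {1, …, m}`. -/
def IsUnionFreeConstant (k : ℕ) (C : ℝ) (m₀ : ℕ) : Prop :=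
  ∀ m : ℕ, m₀ ≤ m → ∀ r ∈ Finset.Icc 1 m,
    (maxUnionFree k r m : ℝ) ≤ C * (m : ℝ) ^ ⌈(r : ℝ) / ((k : ℝ) - 1)⌉₊

end Tomography

namespace Tomography

/-! For (i), put `t = ⌈r/(k-1)⌉`. If every `t`-subset of an edge `A` lay in another edge, cutting
`A` into at most `k - 1` pieces of size at most `t` would cover `A` by at most `k - 1` other edges,
and adding `A` to them would not change their union. So each edge owns a `t`-subset, and `f(k,r,m) ≤
m.choose t ≤ m ^ t`: `C = 1`, `m₀ = 0` work for all `k`. For (ii), identify a node with its set of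
paths. Identifiability makes these sets distinct, nonempty and `k`-union-free; sorting them by size
`r` gives `n ≤ ∑ f(k,r,m)`. -/

/-- If every subset of `A` with at most `t` elements lies in a member of `G`, then every subset of
`A` with at most `s * t` elements is covered by at most `s` members of `G`. -/
theorem exists_cover_of_small_subsets {α : Type*} [DecidableEq α] {A : Finset α}
    {G : Finset (Finset α)} {t : ℕ} (h : ∀ T ⊆ A, T.card ≤ t → ∃ B ∈ G, T ⊆ B) (s : ℕ) :
    ∀ S ⊆ A, S.card ≤ s * t → ∃ H ⊆ G, H.card ≤ s ∧ S ⊆ H.biUnion id := by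
  induction s with
  | zero =>
    intro S _ hS
    have : S = ∅ := by simpa using hS
    exact ⟨∅, by simp, by simp, by simp [this]⟩
  | succ s ih =>
    intro S hSA hS
    obtain ⟨T, hTS, hT⟩ := Finset.exists_subset_card_eq (Nat.min_le_right t S.card)
    obtain ⟨B, hBG, hTB⟩ := h T (hTS.trans hSA) (hT.trans_le (Nat.min_le_left _ _))
    obtain ⟨H, hHG, hHs, hSH⟩ := ih (S \ T) (Finset.sdiff_subset.trans hSA) (by
      rw [Finset.card_sdiff_of_subset hTS, hT]
      rw [add_mul] at hS
      omega)
    refine ⟨insert B H, Finset.insert_subset hBG hHG,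
      (Finset.card_insert_le _ _).trans (by omega), fun x hx => ?_⟩
    rw [Finset.biUnion_insert, Finset.mem_union]
    by_cases hxT : x ∈ T
    · exact Or.inl (hTB hxT)
    · exact Or.inr (hSH (Finset.mem_sdiff.2 ⟨hx, hxT⟩))

/-- In a `k`-union-free hypergraph no edge is covered by between `1` and `k - 1` other edges. -/
theorem IsUnionFree.not_subset_biUnion {m k : ℕ} {F : Finset (Finset (Fin m))}
    (hF : IsUnionFree k F) {A : Finset (Fin m)} (hA : A ∈ F) {H : Finset (Finset (Fin m))}
    (hH : H ⊆ F.erase A) (h1 : 1 ≤ H.card) (hk : H.card + 1 ≤ k) : ¬ A ⊆ H.biUnion id := by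
  intro hsub
  have hAH : A ∉ H := fun h => by simpa using hH h
  have hHF : H ⊆ F := hH.trans (Finset.erase_subset _ _)
  have hc : (insert A H).card = H.card + 1 := Finset.card_insert_of_notMem hAH
  -- `insert A H` and `H` are distinct subfamilies with the same union.
  refine hF (insert A H) H (Finset.insert_subset hA hHF) hHF (by omega) (by omega) h1 (by omega)
    (fun h => hAH (h ▸ Finset.mem_insert_self A H)) ?_
  rw [Finset.biUnion_insert]
  exact Finset.union_eq_right.2 hsub

/-- Every edge of size `r ≤ (k - 1) t` of a `k`-union-free hypergraph has a subset of size `t`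
that lies in no other edge. -/
theorem IsUnionFree.exists_own_subset {m k r t : ℕ} {F : Finset (Finset (Fin m))}
    (hF : IsUnionFree k F) (hk : 2 ≤ k) (hr : 1 ≤ r) (htr : t ≤ r) (hrt : r ≤ (k - 1) * t)
    {A : Finset (Fin m)} (hA : A ∈ F) (hAr : A.card = r) :
    ∃ T ⊆ A, T.card = t ∧ ∀ B ∈ F, T ⊆ B → B = A := by
  by_contra! hcon
  have hsmall : ∀ T ⊆ A, T.card ≤ t → ∃ B ∈ F.erase A, T ⊆ B := by
    intro T hTA hT
    -- `hcon` speaks of size exactly `t`, so smaller sets are enlarged inside `A`.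
    obtain ⟨T', hTT', hT'A, hT'⟩ := Finset.exists_subsuperset_card_eq hTA hT (hAr ▸ htr)
    obtain ⟨B, hBF, hTB, hBA⟩ := hcon T' hT'A hT'
    exact ⟨B, Finset.mem_erase.2 ⟨hBA, hBF⟩, hTT'.trans hTB⟩
  obtain ⟨H, hHF, hHk, hAH⟩ :=
    exists_cover_of_small_subsets hsmall (k - 1) A subset_rfl (hAr ▸ hrt)
  refine hF.not_subset_biUnion hA hHF ?_ (by omega) hAH
  rw [Nat.one_le_iff_ne_zero, Ne, Finset.card_eq_zero]
  rintro rfl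
  have : A = ∅ := by simpa using hAH
  simp [this] at hAr
  omega

/-- Sending an edge to a `t`-subset it owns is injective. -/
theorem IsUnionFree.card_le_choose {m k r t : ℕ} {F : Finset (Finset (Fin m))}
    (hF : IsUnionFree k F) (hreg : IsRegular r F) (hk : 2 ≤ k) (hr : 1 ≤ r) (htr : t ≤ r)
    (hrt : r ≤ (k - 1) * t) : F.card ≤ m.choose t := by
  have hown : ∀ A ∈ F, ∃ T ⊆ A, T.card = t ∧ ∀ B ∈ F, T ⊆ B → B = A :=
    fun A hA => hF.exists_own_subset hk hr htr hrt hA (hreg A hA)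
  choose! T hTA hT hown using hown
  have hcard : F.card ≤ (Finset.powersetCard t (Finset.univ : Finset (Fin m))).card :=
    Finset.card_le_card_of_injOn T (fun A hA => by simpa using hT A hA) fun A hA B hB hAB =>
      hown B hB A hA (hAB ▸ hTA A hA)
  simpa using hcard

open Classical in
theorem maxUnionFree_le_choose {m k r t : ℕ} (hk : 2 ≤ k) (hr : 1 ≤ r) (htr : t ≤ r)
    (hrt : r ≤ (k - 1) * t) : maxUnionFree k r m ≤ m.choose t := by
  refine Finset.sup_le fun F hF => ?_
  obtain ⟨-, hfree, hreg⟩ := Finset.mem_filter.1 hF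
  exact hfree.card_le_choose hreg hk hr htr hrt

open Classical in
theorem IsUnionFree.card_le_maxUnionFree {m k r : ℕ} {F : Finset (Finset (Fin m))}
    (hF : IsUnionFree k F) (hreg : IsRegular r F) : F.card ≤ maxUnionFree k r m :=
  Finset.le_sup (f := Finset.card) (Finset.mem_filter.2 ⟨Finset.mem_univ F, hF, hreg⟩)

theorem isUnionFreeConstant_one {k : ℕ} (hk : 2 ≤ k) : IsUnionFreeConstant k 1 0 := by
  intro m _ r hr
  have hr1 : 1 ≤ r := (Finset.mem_Icc.1 hr).1
  have hk1 : (1 : ℝ) ≤ (k : ℝ) - 1 := by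
    have : (2 : ℝ) ≤ k := by exact_mod_cast hk
    linarith
  set t := ⌈(r : ℝ) / ((k : ℝ) - 1)⌉₊ with ht
  have htr : t ≤ r := Nat.ceil_le.2 (div_le_self (Nat.cast_nonneg r) hk1)
  have hrt : r ≤ (k - 1) * t := by
    have h := (div_le_iff₀ (by linarith : (0 : ℝ) < (k : ℝ) - 1)).1
      (Nat.le_ceil ((r : ℝ) / ((k : ℝ) - 1)))
    rw [← ht] at h
    have hc : (((k - 1 : ℕ) : ℝ)) = (k : ℝ) - 1 := by
      rw [Nat.cast_sub (by omega), Nat.cast_one]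
    rw [← hc, mul_comm] at h
    exact_mod_cast h
  rw [one_mul]
  exact_mod_cast (maxUnionFree_le_choose hk hr1 htr hrt).trans (Nat.choose_le_pow m t)

namespace PathSystem

variable {m n : ℕ} {P : PathSystem m n} {k : ℕ}

theorem IsIdentifiable.mono {l : ℕ} (hP : P.IsIdentifiable l) (hkl : k ≤ l) :
    P.IsIdentifiable k :=
  fun U W hU hW => hP U W (hU.trans hkl) (hW.trans hkl)

open Classical in
theorem maxIdentifiability_lt (hk : 0 < k) (hP : ¬ P.IsIdentifiable k) :
    P.maxIdentifiability < k := by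
  by_contra! hle
  -- The value is at least `k > 0`, so it is not the default `0` of `Nat.findGreatest` and is
  -- attained.
  exact hP (IsIdentifiable.mono
    (Nat.findGreatest_of_ne_zero (m := P.maxIdentifiability) rfl (by omega)) hle)

theorem touching_eq_biUnion_image (U : Finset (Fin n)) :
    P.touching U = (U.image fun u => P.touching {u}).biUnion id := by
  simp [touching, Finset.image_biUnion]

theorem IsIdentifiable.injective_touching_singleton (hP : P.IsIdentifiable k) (hk : 1 ≤ k) :
    Function.Injective fun u => P.touching {u} := by
  intro u v huv
  by_contra hne
  exact hP {u} {v} (by simpa using hk) (by simpa using hk) (by simpa using hne) huv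

theorem IsIdentifiable.one_le_card_touching_singleton (hP : P.IsIdentifiable k) (hk : 1 ≤ k)
    (u : Fin n) : 1 ≤ (P.touching {u}).card := by
  rw [Finset.one_le_card, Finset.nonempty_iff_ne_empty]
  -- A node on no path would be indistinguishable from the empty node set.
  have h := hP {u} ∅ (by simpa using hk) (by simp) (by simp)
  simpa [touching] using h

/-- The columns of a `k`-identifiable path system form a `k`-union-free hypergraph. -/
theorem IsIdentifiable.isUnionFree_image (hP : P.IsIdentifiable k) (hk : 1 ≤ k)
    (V : Finset (Fin n)) : IsUnionFree k (V.image fun u => P.touching {u}) := by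
  have hinj := hP.injective_touching_singleton hk
  intro A B hA hB _ hAk _ hBk hAB
  obtain ⟨U, -, rfl⟩ := Finset.subset_image_iff.1 hA
  obtain ⟨W, -, rfl⟩ := Finset.subset_image_iff.1 hB
  rw [Finset.card_image_of_injective _ hinj] at hAk hBk
  rw [← touching_eq_biUnion_image, ← touching_eq_biUnion_image]
  exact hP U W hAk hBk fun h => hAB (h ▸ rfl)

theorem IsIdentifiable.card_nodes_le (hP : P.IsIdentifiable k) (hk : 1 ≤ k) :
    n ≤ ∑ r ∈ Finset.Icc 1 m, maxUnionFree k r m := by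
  have hmaps : ∀ u ∈ (Finset.univ : Finset (Fin n)), (P.touching {u}).card ∈ Finset.Icc 1 m :=
    fun u _ => Finset.mem_Icc.2 ⟨hP.one_le_card_touching_singleton hk u, by
      simpa using Finset.card_le_univ (P.touching {u})⟩
  calc n = (Finset.univ : Finset (Fin n)).card := by simp
    _ = ∑ r ∈ Finset.Icc 1 m,
          (Finset.univ.filter fun u : Fin n => (P.touching {u}).card = r).card :=
        Finset.card_eq_sum_card_fiberwise hmaps
    _ ≤ ∑ r ∈ Finset.Icc 1 m, maxUnionFree k r m := by
        refine Finset.sum_le_sum fun r _ => ?_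
        rw [← Finset.card_image_of_injective _ (hP.injective_touching_singleton hk)]
        refine (hP.isUnionFree_image hk _).card_le_maxUnionFree fun A hA => ?_
        obtain ⟨u, hu, rfl⟩ := Finset.mem_image.1 hA
        exact (Finset.mem_filter.1 hu).2

end PathSystem

end Tomography

theorem mainTheorem3 :
    (∃ (C : ℝ) (m₀ : ℕ), 0 < C ∧ ∀ k : ℕ, 2 ≤ k → Tomography.IsUnionFreeConstant k C m₀) ∧
    (∀ (k : ℕ) (C : ℝ) (m₀ : ℕ), 2 ≤ k → Tomography.IsUnionFreeConstant k C m₀ →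
      ∀ (m n : ℕ) (P : Tomography.PathSystem m n), m₀ ≤ m →
        (∑ r ∈ Finset.Icc 1 m, C * (m : ℝ) ^ ⌈(r : ℝ) / ((k : ℝ) - 1)⌉₊) < (n : ℝ) →
          ¬ P.IsIdentifiable k ∧ P.maxIdentifiability < k) := by
  refine ⟨⟨1, 0, one_pos, fun k hk => Tomography.isUnionFreeConstant_one hk⟩, ?_⟩
  intro k C m₀ hk hC m n P hm hn
  have hnot : ¬ P.IsIdentifiable k := by
    intro hP
    have hle : (n : ℝ) ≤ ∑ r ∈ Finset.Icc 1 m, (Tomography.maxUnionFree k r m : ℝ) := by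
      exact_mod_cast hP.card_nodes_le (by omega)
    exact absurd (hle.trans (Finset.sum_le_sum fun r hr => hC m hm r hr)) (not_le.2 hn)
  exact ⟨hnot, Tomography.PathSystem.maxIdentifiability_lt (by omega) hnot⟩
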